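/- A structure here is a countable structure in a countable relational signature; the signature may vary from structure to structure. A structure is $\omega$-categorical if for every $n$ the componentwise action of its automorphism group on $n$-tuples of elements has finitely many orbits. Such structures are encoded by 0-1-sequences that list the elements of the domain (a subset of $\mathbb N$), the symbols of the signature (the $i$-th symbol of arity $n$, $n,i\in\mathbb N$), and the tuples in the relations; the codes of $\omega$-categorical structures carry the Borel structure inherited from the Polish space of all codes. An equivalence relation on a Borel space is smooth if it Borel-reduces to equality on $\mathbb R$. Existential positive (ep) formulas are $\exists x_1\cdots\exists x_m\,\phi$ with $\phi$ quantifier-free without negation; primitive positive (pp) formulas are those where $\phi$ is a conjunction of atomic formulas. Equality, $\top$ and $\bot$ are allowed as atomic formulas; definability is without parameters. A bijection $\theta$ between the domains of $\mathbb A$ and $\mathbb B$ is an (fo/ep/pp)-bi-definition if $\theta$ and $\theta^{-1}$ map (fo/ep/pp)-definable relations onto (fo/ep/pp)-definable relations; $\mathbb A$ and $\mathbb B$ are (fo/ep/pp)-bi-definable if such a $\theta$ exists. For a set $\mathcal A$ of finitary operations on a set $\Omega$ let $\mathbb E_{\mathcal A}$ be the structure with domain $\Omega$ and, for all $k,n\ge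 1$, the $(k+1)n$-ary relation $$O_{k,n}=\{(x_1,\dots,x_k,f(x_1,\dots,x_k)) \mid x_1,\dots,x_k\in\Omega^n,\ f\in\mathcal A\text{ of arity }k\},$$ where $f$ is applied componentwise. Let $\mathcal S=\operatorname{Aut}$ (automorphisms, as unary operations), $\operatorname{End}$ (endomorphisms) or $\operatorname{Pol}$ (polymorphisms of all arities $k\ge 1$) in the fo-, ep- and pp-case, respectively. **Theorem.** In each of the three cases: 1. The relation of (fo/ep/pp)-bi-definability on the Borel space of $\omega$-categorical structures is smooth. 2. More precisely, the map $\mathbb A\mapsto \operatorname{Th}(\mathbb E_{\mathcal S(\mathbb A)})$, which sends $\mathbb A$ to the first-order theory of $\mathbb E_{\mathcal S(\mathbb A)}$ (a point of the space of sets of sentences in the countable language $\{O_{k,n}\mid k,n\ge1\}$), is a Borel reduction to equality: it is Borel, and $\mathbb A,\mathbb B$ are (fo/ep/pp)-bi-definable if and only if $\operatorname{Th}(\mathbb E_{\mathcal S(\mathbb A)})=\operatorname{Th}(\mathbb E_{\mathcal S(\mathbb B)})$. 3. For $\omega$-categorical $\mathbb A$ the structure $\mathbb E_{\mathcal S(\mathbb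 A)}$ is $\omega$-categorical. 4. $\mathbb E_{\mathcal S(\mathbb A)}$ encodes the action of $\mathcal S(\mathbb A)$: for $\omega$-categorical $\mathbb A,\mathbb B$, a bijection $\theta$ between their domains is an isomorphism $\mathbb E_{\mathcal S(\mathbb A)}\to\mathbb E_{\mathcal S(\mathbb B)}$ if and only if it is an isomorphism of the actions, i.e. $\mathcal S(\mathbb B)=\{\theta\circ f\circ\theta^{-1}\mid f\in\mathcal S(\mathbb A)\}$, with $\theta^{-1}$ applied to every argument. -/

import Mathlib

namespace BiDef

open FirstOrder FirstOrder.Language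

/-! ### Borel reducibility -/

/-- `f` is a Borel reduction from `r` on `X` to `s` on `Y`. -/
def IsBorelReduction {X Y : Type} [MeasurableSpace X] [MeasurableSpace Y]
    (r : X → X → Prop) (s : Y → Y → Prop) (f : X → Y) : Prop :=
  Measurable f ∧ ∀ x y, r x y ↔ s (f x) (f y)

/-- `r` is smooth: it Borel-reduces to equality on the real numbers. -/
def SmoothRel {X : Type} [MeasurableSpace X] (r : X → X → Prop) : Prop :=
  ∃ f : X → ℝ, IsBorelReduction r (fun a b : ℝ => a = b) f

/-! ### The three kinds of definability -/

/-- First-order, existential positive, primitive positive. -/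
inductive Kind
  | fo
  | ep
  | pp

section Formulas

variable {L : FirstOrder.Language.{0, 0}} {α : Type} {m : ℕ}

/-- Quantifier-free formulas without negation: built from atomic formulas
(equality included), `⊥` and `⊤` by conjunction and disjunction. -/
inductive IsPositiveQF : L.BoundedFormula α m → Prop
  | falsum : IsPositiveQF ⊥
  | verum : IsPositiveQF ⊤
  | atomic {φ : L.BoundedFormula α m} : φ.IsAtomic → IsPositiveQF φ
  | inf {φ ψ : L.BoundedFormula α m} : IsPositiveQF φ → IsPositiveQF ψ → IsPositiveQF (φ ⊓ ψ)
  | sup {φ ψ : L.BoundedFormula α m} : IsPositiveQF φ → IsPositiveQF ψ → IsPositiveQF (φ ⊔ ψ)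

/-- Conjunctions of atomic formulas (equality, `⊥` and `⊤` included). -/
inductive IsAtomicConj : L.BoundedFormula α m → Prop
  | falsum : IsAtomicConj ⊥
  | verum : IsAtomicConj ⊤
  | atomic {φ : L.BoundedFormula α m} : φ.IsAtomic → IsAtomicConj φ
  | inf {φ ψ : L.BoundedFormula α m} : IsAtomicConj φ → IsAtomicConj ψ → IsAtomicConj (φ ⊓ ψ)

/-- `φ` is a first-order / existential positive / primitive positive formula.
Here `ψ.exs` is `∃ y₁ ⋯ ∃ yₘ, ψ`. -/
def IsOfKind : Kind → L.Formula α → Prop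
  | .fo, _ => True
  | .ep, φ => ∃ (m : ℕ) (ψ : L.BoundedFormula α m), IsPositiveQF ψ ∧ φ = ψ.exs
  | .pp, φ => ∃ (m : ℕ) (ψ : L.BoundedFormula α m), IsAtomicConj ψ ∧ φ = ψ.exs

end Formulas

section Structures

variable (L : FirstOrder.Language.{0, 0}) (M : Type) [L.Structure M]

/-- The relation `R` is (fo/ep/pp)-definable in `M`, without parameters. -/
def IsDefinable (s : Kind) {n : ℕ} (R : Set (Fin n → M)) : Prop :=
  ∃ φ : L.Formula (Fin n), IsOfKind s φ ∧ ∀ x, x ∈ R ↔ φ.Realize x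

/-- `M` is ω-categorical: the componentwise action of its automorphism group on `n`-tuples
has finitely many orbits, for every `n`. -/
def IsOmegaCategorical : Prop :=
  ∀ n : ℕ, Finite (Quot fun x y : Fin n → M => ∃ g : M ≃[L] M, ∀ i, y i = g (x i))

end Structures

/-- `θ` is a (fo/ep/pp)-bi-definition: `θ` and its inverse map definable relations to definable
relations. -/
def IsBiDefinition (s : Kind) (L L' : FirstOrder.Language.{0, 0}) {M N : Type} [L.Structure M]
    [L'.Structure N] (θ : M ≃ N) : Prop :=
  (∀ (n : ℕ) (R : Set (Fin n → M)), IsDefinable L M s R →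
    IsDefinable L' N s ((fun (x : Fin n → M) (i : Fin n) => θ (x i)) '' R)) ∧
  (∀ (n : ℕ) (R : Set (Fin n → N)), IsDefinable L' N s R →
    IsDefinable L M s ((fun (x : Fin n → N) (i : Fin n) => θ.symm (x i)) '' R))

/-! ### Sets of finitary operations and symmetries -/

/-- A set of finitary operations on `M`, sorted by arity. -/
abbrev Ops (M : Type) : Type := (k : ℕ) → Set ((Fin k → M) → M)

section Symmetries

variable (L : FirstOrder.Language.{0, 0}) (M : Type) [L.Structure M]

/-- The automorphisms, as unary operations. -/
def autOps : Ops M := fun k =>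
  {f | ∃ h : k = 1, ∃ g : M ≃[L] M, ∀ x : Fin k → M, f x = g (x ⟨0, by omega⟩)}

/-- The endomorphisms, as unary operations. -/
def endOps : Ops M := fun k =>
  {f | ∃ h : k = 1, ∃ g : M →[L] M, ∀ x : Fin k → M, f x = g (x ⟨0, by omega⟩)}

/-- The polymorphisms: operations of arity `k ≥ 1` that preserve all relations. -/
def polOps : Ops M := fun k =>
  {f | 1 ≤ k ∧ ∀ (n : ℕ) (R : L.Relations n) (x : Fin k → Fin n → M),
    (∀ i, Structure.RelMap R (x i)) → Structure.RelMap R (fun j => f (fun i => x i j))}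

/-- The symmetry object that belongs to a kind of definability. -/
def symOps : Kind → Ops M
  | .fo => autOps L M
  | .ep => endOps L M
  | .pp => polOps L M

end Symmetries

/-- `θ` is an isomorphism of actions: conjugation by `θ` maps `𝒜` onto `ℬ`. -/
def IsActionIso {M N : Type} (𝒜 : Ops M) (ℬ : Ops N) (θ : M ≃ N) : Prop :=
  ∀ k : ℕ, ℬ k = (fun (f : (Fin k → M) → M) (y : Fin k → N) =>
    θ (f (fun i => θ.symm (y i)))) '' 𝒜 k

/-! ### The structure `𝔼_𝒜` -/

/-- For all `k, n ≥ 1` a relation symbol `O_{k,n}` of arity `(k + 1) n`. -/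
inductive OrbitRel : ℕ → Type
  | O (k n : ℕ) (hk : 1 ≤ k) (hn : 1 ≤ n) : OrbitRel ((k + 1) * n)

/-- The relational language with the symbols `O_{k,n}`. -/
def orbitLang : FirstOrder.Language.{0, 0} := ⟨fun _ => Empty, OrbitRel⟩

/-- The domain of `𝔼_𝒜` is the domain of `𝒜`. -/
def E {M : Type} (_𝒜 : Ops M) : Type := M

/-- `O_{k,n}` holds of a tuple that consists of `k + 1` blocks `x₁, …, x_k, y` of length `n` iff
`y = f (x₁, …, x_k)`, componentwise, for some `k`-ary `f ∈ 𝒜`. Entry `j` of block `i`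
has position `n * i + j`, which is `finProdFinEquiv (i, j)`. -/
def orbitRelMap {M : Type} (𝒜 : Ops M) : {r : ℕ} → OrbitRel r → (Fin r → M) → Prop
  | _, .O k n _ _, t => ∃ f ∈ 𝒜 k, ∀ j : Fin n,
      t (finProdFinEquiv (Fin.last k, j)) =
        f (fun i : Fin k => t (finProdFinEquiv (i.castSucc, j)))

instance {M : Type} (𝒜 : Ops M) : orbitLang.Structure (E 𝒜) where
  funMap f _ := Empty.elim f
  RelMap R t := orbitRelMap 𝒜 R t

/-! ### The Borel space of countable relational structures -/

/-- Codes of countable structures in countable relational signatures: a code is a triple of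
0-1-sequences that list the elements of the domain (a subset of `ℕ`), the symbols in the
signature (the pair `(n, i)` is the `i`-th potential symbol of arity `n`), and the tuples that
belong to the relations. The σ-algebra is the product (Borel) one. -/
abbrev Code : Type :=
  (ℕ → Bool) × (ℕ × ℕ → Bool) × ((Σ n : ℕ, ℕ × (Fin n → ℕ)) → Bool)

/-- The domain of the coded structure. -/
def Code.Dom (c : Code) : Type := {a : ℕ // c.1 a = true}

/-- The signature of the coded structure. -/
def Code.lang (c : Code) : FirstOrder.Language.{0, 0} :=
  ⟨fun _ => Empty, fun n => {i : ℕ // c.2.1 (n, i) = true}⟩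

/-- The coded structure. Entries of the third sequence for tuples outside of the domain, or
symbols outside of the signature, play no role. -/
instance (c : Code) : c.lang.Structure c.Dom where
  funMap f _ := Empty.elim f
  RelMap {n} R x := c.2.2 ⟨n, R.1, fun j => (x j).1⟩ = true

/-- The Borel space of (codes of) ω-categorical structures. -/
abbrev OmegaCat : Type := {c : Code // IsOmegaCategorical c.lang c.Dom}

/-- The ω-categorical structures `A` and `B` are (fo/ep/pp)-bi-definable. -/
def BiDefinable (s : Kind) (A B : OmegaCat) : Prop :=
  ∃ θ : A.1.Dom ≃ B.1.Dom, IsBiDefinition s A.1.lang B.1.lang θ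

/-- `𝒮(A)`, where `𝒮` is `Aut`, `End`, `Pol` for fo, ep, pp. -/
def sym (s : Kind) (A : OmegaCat) : Ops A.1.Dom := symOps A.1.lang A.1.Dom s

/-- `Th(𝔼_{𝒮(A)})`, a point of the Borel space of sets of sentences, that is, of 0-1-sequences
indexed by the countably many sentences. -/
def symTheory (s : Kind) (A : OmegaCat) : Set orbitLang.Sentence :=
  orbitLang.completeTheory (E (sym s A))

end BiDef

/-!
Everything rests on two facts about a countable ω-categorical relational structure `M`.

First, every definable set is invariant under automorphisms, so for each `n` there are only finitely
many definable `n`-ary sets. Hence the intersection of all definable sets that contain given tuples,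
their definable hull, is itself definable. If `y` lies in the hull of `x₁, …, x_k`, then after
appending one entry to each `xᵢ`, the hull of the extended tuples projects onto a definable set that
contains every `xᵢ`, hence `y`; so `y` can be extended as well. Iterating this along an enumeration
of `M ^ k` gives a `k`-ary operation that maps `x₁, …, x_k` to `y` and preserves all relations. For
first-order formulas the same step, in both directions, is the back-and-forth argument that matches
tuples of equal type by an isomorphism. In summary (`exists_mem_symOps_iff`), some `k`-ary symmetry
maps `x₁, …, x_k` to `y` iff every formula of the given kind true at all `xᵢ` is true at `y`.

Second, this implies the Galois connection `defSet_iff_forall_preserves`: a relation is definable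
iff all symmetries preserve it. In the pp-case, finitely many tuples of the relation have the same
definable hull as the whole relation; in the fo- and ep-cases the relation is the finite union of
the hulls of its elements.

The Galois connection turns bi-definitions into isomorphisms of the actions
(`isBiDefinition_iff_isActionIso`). An isomorphism of actions preserves the relations `O_{k,n}`;
conversely, an isomorphism of the structures `𝔼` conjugates symmetries to operations that agree with
symmetries on finite sets, hence preserve all definable sets, and such conjugates are symmetries
(`exists_equiv_E_iff_isActionIso`). Automorphisms of `M` are bi-definitions, thus automorphisms of
its `𝔼`, which is therefore ω-categorical. Being countable and ω-categorical, the structures `𝔼` are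
isomorphic iff they have the same theory.

For measurability, all codes are read in one signature of potential symbols, where unused symbols
denote empty relations; this does not affect the symmetries. Satisfaction of a formula in a
measurable family of structures on subsets of `ℕ` is measurable (`measurableSet_realize`). Applied
to the codes, together with `exists_mem_symOps_iff`, this shows that the relations `O_{k,n}` are
Borel; applied to the structures `𝔼`, that the theory is Borel.
-/

namespace BiDef

open FirstOrder FirstOrder.Language

/-! ### Definable sets and their closure properties -/

section DefinableSets

variable {L : FirstOrder.Language.{0, 0}} {M : Type} [L.Structure M] {α β γ δ : Type}

variable (L) in
/-- Sets of assignments `γ → M` defined by conjunctions of atomic formulas in relational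
languages. If `u` is true, disjunctions are allowed as well. -/
inductive QFSet (u : Prop) : Set (γ → M) → Prop
  | empty : QFSet u ∅
  | univ : QFSet u Set.univ
  | eq (i j : γ) : QFSet u {x | x i = x j}
  | rel {n : ℕ} (R : L.Relations n) (σ : Fin n → γ) :
      QFSet u {x | Structure.RelMap R fun i => x (σ i)}
  | inter {S T : Set (γ → M)} : QFSet u S → QFSet u T → QFSet u (S ∩ T)
  | union {S T : Set (γ → M)} : u → QFSet u S → QFSet u T → QFSet u (S ∪ T)

theorem QFSet.preimage_comp {u : Prop} {S : Set (γ → M)} (h : QFSet L u S) (σ : γ → δ) :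
    QFSet L u {x : δ → M | x ∘ σ ∈ S} := by
  induction h with
  | empty => exact .empty
  | univ => exact .univ
  | eq i j => exact .eq (σ i) (σ j)
  | rel R τ => exact .rel R (σ ∘ τ)
  | inter _ _ h₁ h₂ => exact .inter h₁ h₂
  | union hu _ _ h₁ h₂ => exact .union hu h₁ h₂

theorem term_eq_var [L.IsRelational] (t : L.Term γ) : ∃ i, t = Term.var i := by
  cases t with
  | var i => exact ⟨i, rfl⟩
  | func f _ => exact isEmptyElim f

theorem QFSet.of_isAtomic [L.IsRelational] {u : Prop} {m : ℕ} {ψ : L.BoundedFormula α m}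
    (h : ψ.IsAtomic) :
    QFSet L u {z : α ⊕ Fin m → M | ψ.Realize (z ∘ Sum.inl) (z ∘ Sum.inr)} := by
  cases h with
  | equal t₁ t₂ =>
    obtain ⟨i, rfl⟩ := term_eq_var t₁
    obtain ⟨j, rfl⟩ := term_eq_var t₂
    simpa using QFSet.eq i j
  | rel R ts =>
    choose σ hσ using fun i => term_eq_var (ts i)
    simpa [hσ, BoundedFormula.realize_rel] using QFSet.rel R σ

theorem QFSet.of_isPositiveQF [L.IsRelational] {u : Prop} (hu : u) {m : ℕ}
    {ψ : L.BoundedFormula α m} (h : IsPositiveQF ψ) :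
    QFSet L u {z : α ⊕ Fin m → M | ψ.Realize (z ∘ Sum.inl) (z ∘ Sum.inr)} := by
  induction h with
  | falsum => exact .empty
  | verum => simpa using QFSet.univ
  | atomic h => exact .of_isAtomic h
  | inf _ _ h₁ h₂ => simpa [Set.ofPred_and] using h₁.inter h₂
  | sup _ _ h₁ h₂ => simpa [Set.ofPred_or] using QFSet.union hu h₁ h₂

theorem QFSet.of_isAtomicConj [L.IsRelational] {u : Prop} {m : ℕ}
    {ψ : L.BoundedFormula α m} (h : IsAtomicConj ψ) :
    QFSet L u {z : α ⊕ Fin m → M | ψ.Realize (z ∘ Sum.inl) (z ∘ Sum.inr)} := by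
  induction h with
  | falsum => exact .empty
  | verum => simpa using QFSet.univ
  | atomic h => exact .of_isAtomic h
  | inf _ _ h₁ h₂ => simpa [Set.ofPred_and] using h₁.inter h₂

theorem QFSet.exists_boundedFormula {u : Prop} {m : ℕ} {S : Set (γ → M)} (h : QFSet L u S)
    (τ : γ → α ⊕ Fin m) :
    ∃ ψ : L.BoundedFormula α m, IsPositiveQF ψ ∧ (¬ u → IsAtomicConj ψ) ∧
      ∀ x y, ψ.Realize x y ↔ Sum.elim x y ∘ τ ∈ S := by
  induction h with
  | empty => exact ⟨⊥, .falsum, fun _ => .falsum, by simp⟩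
  | univ => exact ⟨⊤, .verum, fun _ => .verum, by simp⟩
  | eq i j =>
    have h := BoundedFormula.IsAtomic.equal (L := L) (Term.var (τ i)) (Term.var (τ j))
    exact ⟨_, .atomic h, fun _ => .atomic h, by simp⟩
  | rel R σ =>
    have h := BoundedFormula.IsAtomic.rel (L := L) R fun i => Term.var (τ (σ i))
    exact ⟨_, .atomic h, fun _ => .atomic h, by simp [BoundedFormula.realize_rel]⟩
  | inter _ _ h₁ h₂ =>
    obtain ⟨ψ₁, p₁, c₁, r₁⟩ := h₁
    obtain ⟨ψ₂, p₂, c₂, r₂⟩ := h₂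
    exact ⟨ψ₁ ⊓ ψ₂, .inf p₁ p₂, fun hu => .inf (c₁ hu) (c₂ hu), by simp [r₁, r₂]⟩
  | union hu _ _ h₁ h₂ =>
    obtain ⟨ψ₁, p₁, c₁, r₁⟩ := h₁
    obtain ⟨ψ₂, p₂, c₂, r₂⟩ := h₂
    exact ⟨ψ₁ ⊔ ψ₂, .sup p₁ p₂, fun hu' => absurd hu hu', by simp [r₁, r₂]⟩

variable (L) in
/-- `S` is defined by a formula of kind `s` without parameters. Unlike `IsDefinable`, this allows
an arbitrary type `α` of variables. -/
def DefSet (s : Kind) (S : Set (α → M)) : Prop :=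
  ∃ φ : L.Formula α, IsOfKind s φ ∧ ∀ x, x ∈ S ↔ φ.Realize x

theorem defSet_fo_iff {S : Set (α → M)} : DefSet L .fo S ↔ (∅ : Set M).Definable L S := by
  rw [Set.empty_definable_iff]
  constructor
  · rintro ⟨φ, -, h⟩
    exact ⟨φ, Set.ext h⟩
  · rintro ⟨φ, rfl⟩
    exact ⟨φ, trivial, fun x => Iff.rfl⟩

/-- The ep- and pp-definable sets are the projections of the sets in `QFSet`. Finite types of
bound variables spare the renumbering of prenex formulas. -/
theorem defSet_iff_exists_qfSet [L.IsRelational] {s : Kind} (hs : s ≠ .fo) {S : Set (α → M)} :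
    DefSet L s S ↔ ∃ (β : Type) (_ : Finite β) (Q : Set (α ⊕ β → M)),
      QFSet L (s = .ep) Q ∧ ∀ x, x ∈ S ↔ ∃ y : β → M, Sum.elim x y ∈ Q := by
  constructor
  · rintro ⟨φ, hφ, hS⟩
    obtain ⟨m, ψ, hQ, rfl⟩ : ∃ (m : ℕ) (ψ : L.BoundedFormula α m),
        QFSet L (s = .ep) {z : α ⊕ Fin m → M | ψ.Realize (z ∘ Sum.inl) (z ∘ Sum.inr)} ∧
          φ = ψ.exs := by
      cases s with
      | fo => exact absurd rfl hs
      | ep =>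
        obtain ⟨m, ψ, hψ, rfl⟩ := hφ
        exact ⟨m, ψ, .of_isPositiveQF rfl hψ, rfl⟩
      | pp =>
        obtain ⟨m, ψ, hψ, rfl⟩ := hφ
        exact ⟨m, ψ, .of_isAtomicConj hψ, rfl⟩
    refine ⟨Fin m, inferInstance, _, hQ, fun x => ?_⟩
    rw [hS, BoundedFormula.realize_exs]
    simp
  · rintro ⟨β, _, Q, hQ, hS⟩
    obtain ⟨m, ⟨e⟩⟩ := Finite.exists_equiv_fin β
    obtain ⟨ψ, hp, hc, hr⟩ := hQ.exists_boundedFormula (Sum.map id e)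
    refine ⟨ψ.exs, ?_, fun x => ?_⟩
    · cases s with
      | fo => exact absurd rfl hs
      | ep => exact ⟨m, ψ, hp, rfl⟩
      | pp => exact ⟨m, ψ, hc (by simp), rfl⟩
    · rw [hS, BoundedFormula.realize_exs]
      simp only [hr, Sum.elim_comp_map, Function.comp_id]
      constructor
      · rintro ⟨y, hy⟩
        refine ⟨y ∘ e.symm, ?_⟩
        rwa [Function.comp_assoc, Equiv.symm_comp_self, Function.comp_id]
      · rintro ⟨y, hy⟩
        exact ⟨_, hy⟩

variable {s : Kind}

theorem DefSet.of_qfSet [L.IsRelational] (hs : s ≠ .fo) {S : Set (α → M)}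
    (h : QFSet L (s = .ep) S) : DefSet L s S :=
  (defSet_iff_exists_qfSet hs).2 ⟨Empty, inferInstance, _, h.preimage_comp Sum.inl, fun x => by
    simp⟩

theorem defSet_univ [L.IsRelational] : DefSet L s (Set.univ : Set (α → M)) := by
  by_cases hs : s = .fo
  · subst hs
    exact defSet_fo_iff.2 Set.definable_univ
  · exact .of_qfSet hs .univ

theorem defSet_empty [L.IsRelational] : DefSet L s (∅ : Set (α → M)) := by
  by_cases hs : s = .fo
  · subst hs
    exact defSet_fo_iff.2 Set.definable_empty
  · exact .of_qfSet hs .empty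

theorem defSet_eq [L.IsRelational] (i j : α) : DefSet L s {x : α → M | x i = x j} := by
  by_cases hs : s = .fo
  · subst hs
    exact ⟨(Term.var i).equal (Term.var j), trivial, by simp [Formula.realize_equal]⟩
  · exact .of_qfSet hs (.eq i j)

theorem defSet_rel [L.IsRelational] {n : ℕ} (R : L.Relations n) (σ : Fin n → α) :
    DefSet L s {x : α → M | Structure.RelMap R fun i => x (σ i)} := by
  by_cases hs : s = .fo
  · subst hs
    exact ⟨R.formula fun i => Term.var (σ i), trivial, by simp [Formula.realize_rel]⟩
  · exact .of_qfSet hs (.rel R σ)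

theorem DefSet.inter [L.IsRelational] {S T : Set (α → M)} (hS : DefSet L s S)
    (hT : DefSet L s T) : DefSet L s (S ∩ T) := by
  by_cases hs : s = .fo
  · subst hs
    exact defSet_fo_iff.2 ((defSet_fo_iff.1 hS).inter (defSet_fo_iff.1 hT))
  · obtain ⟨β, _, P, hP, hS⟩ := (defSet_iff_exists_qfSet hs).1 hS
    obtain ⟨γ, _, Q, hQ, hT⟩ := (defSet_iff_exists_qfSet hs).1 hT
    refine (defSet_iff_exists_qfSet hs).2 ⟨β ⊕ γ, inferInstance, _,
      (hP.preimage_comp (Sum.map id Sum.inl)).inter (hQ.preimage_comp (Sum.map id Sum.inr)),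
      fun x => ?_⟩
    simp only [Set.mem_inter_iff, hS, hT, Set.mem_ofPred_eq, Sum.elim_comp_map, Function.comp_id]
    constructor
    · rintro ⟨⟨y, hy⟩, z, hz⟩
      exact ⟨Sum.elim y z, by simpa using hy, by simpa using hz⟩
    · rintro ⟨y, h₁, h₂⟩
      exact ⟨⟨_, h₁⟩, _, h₂⟩

theorem DefSet.union [L.IsRelational] (hs : s ≠ .pp) {S T : Set (α → M)} (hS : DefSet L s S)
    (hT : DefSet L s T) : DefSet L s (S ∪ T) := by
  by_cases hs' : s = .fo
  · subst hs'
    exact defSet_fo_iff.2 ((defSet_fo_iff.1 hS).union (defSet_fo_iff.1 hT))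
  · have hu : s = .ep := by cases s <;> simp_all
    rcases isEmpty_or_nonempty M with _ | ⟨⟨a⟩⟩
    -- Over the empty domain the two tuples of witnesses cannot be merged into one.
    · rcases Set.eq_empty_or_nonempty S with rfl | ⟨x, hx⟩
      · simpa using hT
      · convert defSet_univ (L := L) (α := α) (M := M) (s := s)
        refine Set.eq_univ_of_forall fun y => .inl ?_
        rwa [Subsingleton.elim y x]
    · obtain ⟨β, _, P, hP, hS⟩ := (defSet_iff_exists_qfSet hs').1 hS
      obtain ⟨γ, _, Q, hQ, hT⟩ := (defSet_iff_exists_qfSet hs').1 hT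
      refine (defSet_iff_exists_qfSet hs').2 ⟨β ⊕ γ, inferInstance, _,
        .union hu (hP.preimage_comp (Sum.map id Sum.inl)) (hQ.preimage_comp (Sum.map id Sum.inr)),
        fun x => ?_⟩
      simp only [Set.mem_union, hS, hT, Set.mem_ofPred_eq, Sum.elim_comp_map, Function.comp_id]
      constructor
      · rintro (⟨y, hy⟩ | ⟨z, hz⟩)
        · exact ⟨Sum.elim y fun _ => a, .inl (by simpa using hy)⟩
        · exact ⟨Sum.elim (fun _ => a) z, .inr (by simpa using hz)⟩
      · rintro ⟨y, h | h⟩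
        · exact .inl ⟨_, h⟩
        · exact .inr ⟨_, h⟩

theorem DefSet.preimage_comp [L.IsRelational] {S : Set (α → M)} (hS : DefSet L s S)
    (σ : α → β) : DefSet L s {x : β → M | x ∘ σ ∈ S} := by
  by_cases hs : s = .fo
  · subst hs
    exact defSet_fo_iff.2 ((defSet_fo_iff.1 hS).preimage_comp σ)
  · obtain ⟨γ, _, P, hP, hS⟩ := (defSet_iff_exists_qfSet hs).1 hS
    refine (defSet_iff_exists_qfSet hs).2 ⟨γ, inferInstance, _,
      hP.preimage_comp (Sum.map σ id), fun x => ?_⟩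
    simp [hS, Sum.elim_comp_map]

theorem DefSet.exists_sum [L.IsRelational] [Finite β] {S : Set (α ⊕ β → M)}
    (hS : DefSet L s S) : DefSet L s {x : α → M | ∃ y : β → M, Sum.elim x y ∈ S} := by
  by_cases hs : s = .fo
  · subst hs
    obtain ⟨φ, -, hφ⟩ := hS
    exact ⟨Formula.iExs β φ, trivial, fun x => by simp [hφ]⟩
  · obtain ⟨γ, _, P, hP, hS⟩ := (defSet_iff_exists_qfSet hs).1 hS
    refine (defSet_iff_exists_qfSet hs).2 ⟨β ⊕ γ, inferInstance, _,
      hP.preimage_comp (Equiv.sumAssoc α β γ), fun x => ?_⟩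
    simp only [Set.mem_ofPred_eq, hS]
    constructor
    · rintro ⟨y, z, h⟩
      refine ⟨Sum.elim y z, ?_⟩
      convert h using 1
      ext ((i | i) | i) <;> rfl
    · rintro ⟨w, h⟩
      refine ⟨w ∘ Sum.inl, w ∘ Sum.inr, ?_⟩
      convert h using 1
      ext ((i | i) | i) <;> rfl

/-- Projection along the first coordinate. -/
theorem DefSet.exists_cons [L.IsRelational] {n : ℕ} {S : Set (Fin (n + 1) → M)}
    (hS : DefSet L s S) :
    DefSet L s {x : Fin n → M | ∃ a : M, (Fin.cons a x : Fin (n + 1) → M) ∈ S} := by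
  have h := (hS.preimage_comp (β := Fin n ⊕ Unit)
    (Fin.cons (Sum.inr ()) Sum.inl : Fin (n + 1) → Fin n ⊕ Unit)).exists_sum
  have key : ∀ (x : Fin n → M) (y : Unit → M),
      Sum.elim x y ∘ (Fin.cons (Sum.inr ()) Sum.inl : Fin (n + 1) → Fin n ⊕ Unit) =
        Fin.cons (y ()) x := by
    intro x y
    ext i
    refine Fin.cases ?_ (fun j => ?_) i <;> simp
  simp only [Set.mem_ofPred_eq, key] at h
  convert h using 3
  exact ⟨fun ⟨a, ha⟩ => ⟨fun _ => a, ha⟩, fun ⟨y, hy⟩ => ⟨_, hy⟩⟩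

end DefinableSets

/-! ### Symmetries preserve definable sets -/

section Preservation

variable {L : FirstOrder.Language.{0, 0}} {M : Type} [L.Structure M] {α : Type} {s : Kind}
  {k n : ℕ}

/-- The operation `f`, applied componentwise, maps tuples of elements of `S` into `S`. -/
def Preserves (f : (Fin k → M) → M) (S : Set (α → M)) : Prop :=
  ∀ x : Fin k → α → M, (∀ i, x i ∈ S) → (fun a => f fun i => x i a) ∈ S

theorem QFSet.hom_comp_mem {u : Prop} {S : Set (α → M)} (h : QFSet L u S) (g : M →[L] M)
    {x : α → M} (hx : x ∈ S) : (fun a => g (x a)) ∈ S := by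
  induction h with
  | empty => exact hx
  | univ => trivial
  | eq i j => exact congrArg g hx
  | rel R σ => exact g.map_rel R _ hx
  | inter _ _ h₁ h₂ => exact ⟨h₁ hx.1, h₂ hx.2⟩
  | union _ _ _ h₁ h₂ => exact hx.imp h₁ h₂

theorem QFSet.preserves {u : Prop} (hu : ¬ u) {S : Set (α → M)} (h : QFSet L u S)
    {f : (Fin k → M) → M} (hf : f ∈ polOps L M k) : Preserves f S := by
  intro x hx
  induction h with
  | empty => exact hx ⟨0, hf.1⟩
  | univ => trivial
  | eq a b => exact congrArg f (funext hx)
  | rel R σ => exact hf.2 _ R (fun i j => x i (σ j)) hx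
  | inter _ _ h₁ h₂ => exact ⟨h₁ fun i => (hx i).1, h₂ fun i => (hx i).2⟩
  | union h => exact absurd h hu

theorem DefSet.equiv_comp_mem {S : Set (α → M)} (h : DefSet L s S) (g : M ≃[L] M) {x : α → M} :
    (fun a => g (x a)) ∈ S ↔ x ∈ S := by
  obtain ⟨φ, -, hφ⟩ := h
  rw [hφ, hφ]
  exact StrongHomClass.realize_formula g φ

theorem DefSet.preserves [L.IsRelational] {S : Set (α → M)} (h : DefSet L s S)
    {f : (Fin k → M) → M} (hf : f ∈ symOps L M s k) : Preserves f S := by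
  intro x hx
  cases s with
  | fo =>
    obtain ⟨rfl, g, hg⟩ := hf
    simp only [hg]
    exact (h.equiv_comp_mem g).2 (hx _)
  | ep =>
    obtain ⟨rfl, g, hg⟩ := hf
    obtain ⟨β, _, Q, hQ, hS⟩ := (defSet_iff_exists_qfSet (by simp)).1 h
    obtain ⟨y, hy⟩ := (hS _).1 (hx ⟨0, by omega⟩)
    refine (hS _).2 ⟨g ∘ y, ?_⟩
    convert hQ.hom_comp_mem g hy using 1
    ext (a | a) <;> simp [hg]
  | pp =>
    obtain ⟨β, _, Q, hQ, hS⟩ := (defSet_iff_exists_qfSet (by simp)).1 h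
    choose y hy using fun i => (hS _).1 (hx i)
    refine (hS _).2 ⟨fun b => f fun i => y i b, ?_⟩
    convert hQ.preserves (by simp) hf _ hy using 1
    ext (a | a) <;> simp

end Preservation

/-! ### Definable sets in ω-categorical structures -/

section OmegaCategorical

variable {L : FirstOrder.Language.{0, 0}} {M : Type} [L.Structure M] {s : Kind} {k n : ℕ}

/-- Every definable set is a union of orbits of the automorphism group. -/
theorem finite_setOf_defSet (hM : IsOmegaCategorical L M) (s : Kind) (n : ℕ) :
    {S : Set (Fin n → M) | DefSet L s S}.Finite := by
  have := hM n
  set r : (Fin n → M) → (Fin n → M) → Prop := fun x y => ∃ g : M ≃[L] M, ∀ i, y i = g (x i)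
  refine Set.Finite.subset (Set.finite_range fun T : Set (Quot r) => Quot.mk r ⁻¹' T) ?_
  intro S hS
  refine ⟨Quot.mk r '' S, Set.Subset.antisymm ?_ (Set.subset_preimage_image _ _)⟩
  rintro x ⟨y, hy, hxy⟩
  have hinv : ∀ a b, r a b → (a ∈ S) = (b ∈ S) := by
    rintro a b ⟨g, hg⟩
    obtain rfl : b = fun i => g (a i) := funext hg
    exact propext (hS.equiv_comp_mem g).symm
  exact (congrArg (Quot.lift (· ∈ S) hinv) hxy).mp hy

theorem defSet_sInter [L.IsRelational] (hM : IsOmegaCategorical L M)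
    {P : Set (Set (Fin n → M))} (hP : ∀ S ∈ P, DefSet L s S) : DefSet L s (⋂₀ P) := by
  have hfin : P.Finite := (finite_setOf_defSet hM s n).subset hP
  induction P, hfin using Set.Finite.induction_on with
  | empty => simpa using defSet_univ
  | insert _ _ ih =>
    rw [Set.sInter_insert]
    exact (hP _ (Set.mem_insert _ _)).inter (ih fun S hS => hP S (Set.mem_insert_of_mem _ hS))

theorem defSet_sUnion [L.IsRelational] (hs : s ≠ .pp) (hM : IsOmegaCategorical L M)
    {P : Set (Set (Fin n → M))} (hP : ∀ S ∈ P, DefSet L s S) : DefSet L s (⋃₀ P) := by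
  have hfin : P.Finite := (finite_setOf_defSet hM s n).subset hP
  induction P, hfin using Set.Finite.induction_on with
  | empty => simpa using defSet_empty
  | insert _ _ ih =>
    rw [Set.sUnion_insert]
    exact (hP _ (Set.mem_insert _ _)).union hs (ih fun S hS => hP S (Set.mem_insert_of_mem _ hS))

variable (L s) in
/-- The intersection of the definable sets that contain the tuples `x i`. -/
def defHull {ι : Type} (x : ι → Fin n → M) : Set (Fin n → M) :=
  ⋂₀ {S | DefSet L s S ∧ ∀ i, x i ∈ S}

theorem defSet_defHull [L.IsRelational] (hM : IsOmegaCategorical L M) {ι : Type}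
    (x : ι → Fin n → M) : DefSet L s (defHull L s x) :=
  defSet_sInter hM fun _ hS => hS.1

theorem mem_defHull {ι : Type} (x : ι → Fin n → M) (i : ι) : x i ∈ defHull L s x :=
  fun _ hS => hS.2 i

theorem defHull_subset {ι : Type} {x : ι → Fin n → M} {S : Set (Fin n → M)}
    (hS : DefSet L s S) (hx : ∀ i, x i ∈ S) : defHull L s x ⊆ S :=
  fun _ hy => hy S ⟨hS, hx⟩

end OmegaCategorical

/-! ### Back and forth -/

/-- If every list with the property `T` can be extended, within `T`, by an element that meets any
given one of countably many requirements `C i`, then some set meets all requirements and has all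
its finite subsets contained in lists with the property `T`. -/
theorem exists_set_of_forall_extension {P ι : Type} [Countable ι] (T : List P → Prop)
    (C : ι → P → Prop) (l₀ : List P) (h₀ : T l₀)
    (hext : ∀ l, T l → ∀ i, ∃ p, C i p ∧ T (p :: l)) :
    ∃ G : Set P, (∀ p ∈ l₀, p ∈ G) ∧ (∀ i, ∃ p ∈ G, C i p) ∧
      ∀ F : Set P, F.Finite → F ⊆ G → ∃ l, T l ∧ ∀ p ∈ F, p ∈ l := by
  rcases isEmpty_or_nonempty ι with _ | _
  · exact ⟨{p | p ∈ l₀}, fun _ h => h, isEmptyElim, fun F _ hF => ⟨l₀, h₀, fun p hp => hF hp⟩⟩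
  obtain ⟨e, he⟩ := exists_surjective_nat ι
  choose p hp hT using fun (l : {l // T l}) i => hext l.1 l.2 i
  let step : ℕ → {l // T l} := fun n =>
    Nat.rec ⟨l₀, h₀⟩ (fun n l => ⟨p l (e n) :: l.1, hT l (e n)⟩) n
  have hmono : Monotone fun n => {q | q ∈ (step n).1} :=
    monotone_nat_of_le_succ fun n q hq => List.mem_cons_of_mem _ hq
  refine ⟨⋃ n, {q | q ∈ (step n).1}, fun q hq => Set.mem_iUnion.2 ⟨0, hq⟩, fun i => ?_,
    fun F hF hFG => ?_⟩
  · obtain ⟨n, rfl⟩ := he i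
    exact ⟨_, Set.mem_iUnion.2 ⟨n + 1, List.mem_cons_self⟩, hp (step n) (e n)⟩
  · obtain ⟨n, hn⟩ := hmono.directed_le.exists_mem_subset_of_finset_subset_biUnion
      (s := hF.toFinset) (by simpa using hFG)
    exact ⟨(step n).1, (step n).2, fun q hq => hn (by simpa using hq)⟩

theorem comp_get_cons {P K : Type} (f : P → K) (p : P) (l : List P) :
    (fun j => f ((p :: l).get j)) =
      (Fin.cons (f p) fun j => f (l.get j) : Fin (l.length + 1) → K) := by
  ext j
  refine Fin.cases ?_ (fun j => ?_) j <;> rfl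

section Forth

variable {L : FirstOrder.Language.{0, 0}} [L.IsRelational] {M : Type} [L.Structure M] {s : Kind}
  {k n : ℕ}

/-- One step of the construction of an operation. The definable hull of the extended tuples
`a i, x i` projects onto a definable set that contains all `x i`, hence `y`. -/
theorem exists_cons_of_forall_defSet (hM : IsOmegaCategorical L M) {x : Fin k → Fin n → M}
    {y : Fin n → M} (h : ∀ S, DefSet L s S → (∀ i, x i ∈ S) → y ∈ S) (a : Fin k → M) :
    ∃ b : M, ∀ S : Set (Fin (n + 1) → M), DefSet L s S →
      (∀ i, (Fin.cons (a i) (x i) : Fin (n + 1) → M) ∈ S) →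
        (Fin.cons b y : Fin (n + 1) → M) ∈ S := by
  let z : Fin k → Fin (n + 1) → M := fun i => Fin.cons (a i) (x i)
  obtain ⟨b, hb⟩ := h _ (defSet_defHull (s := s) hM z).exists_cons
    fun i => ⟨a i, mem_defHull z i⟩
  exact ⟨b, fun S hS hx => defHull_subset hS hx hb⟩

theorem exists_operation_of_forall_defSet [Countable M] (hM : IsOmegaCategorical L M)
    {x : Fin k → Fin n → M} {y : Fin n → M}
    (h : ∀ S, DefSet L s S → (∀ i, x i ∈ S) → y ∈ S) :
    ∃ f : (Fin k → M) → M, (∀ j, f (fun i => x i j) = y j) ∧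
      ∀ (m : ℕ) (R : L.Relations m) (z : Fin k → Fin m → M),
        (∀ i, Structure.RelMap R (z i)) → Structure.RelMap R (fun j => f fun i => z i j) := by
  -- A list of argument-value pairs is admissible if the definable relations between the
  -- arguments pass to the values.
  let T : List ((Fin k → M) × M) → Prop := fun l => ∀ S : Set (Fin l.length → M),
    DefSet L s S → (∀ i, (fun j => (l.get j).1 i) ∈ S) → (fun j => (l.get j).2) ∈ S
  obtain ⟨G, hG₀, hG₁, hG₂⟩ := exists_set_of_forall_extension T (fun a p => p.1 = a)
    (List.ofFn fun j => (fun i => x i j, y j)) (by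
      intro S hS hx
      have hlen := List.length_ofFn (f := fun j => ((fun i => x i j, y j) : (Fin k → M) × M))
      have := h _ (hS.preimage_comp (Fin.cast hlen)) fun i => by
        simpa [Function.comp_def, Fin.cast] using hx i
      simpa [Function.comp_def, Fin.cast] using this) (by
      intro l hl a
      obtain ⟨b, hb⟩ := exists_cons_of_forall_defSet hM hl a
      refine ⟨(a, b), rfl, fun S hS hx => ?_⟩
      exact (congrArg (· ∈ S) (comp_get_cons (·.2) (a, b) l)).mpr <| hb S hS fun i =>
        (congrArg (· ∈ S) (comp_get_cons (·.1 i) (a, b) l)).mp (hx i))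
  have key : ∀ {m : ℕ} (p : Fin m → (Fin k → M) × M), (∀ j, p j ∈ G) →
      ∀ S : Set (Fin m → M), DefSet L s S → (∀ i, (fun j => (p j).1 i) ∈ S) →
        (fun j => (p j).2) ∈ S := by
    intro m p hp S hS hx
    obtain ⟨l, hl, hpl⟩ := hG₂ (Set.range p) (Set.finite_range p) (Set.range_subset_iff.2 hp)
    choose σ hσ using fun j => List.get_of_mem (hpl _ ⟨j, rfl⟩)
    simp only [← hσ] at hx ⊢
    exact hl _ (hS.preimage_comp σ) hx
  have hfun : ∀ p ∈ G, ∀ q ∈ G, p.1 = q.1 → p.2 = q.2 := by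
    intro p hp q hq hpq
    simpa using key ![p, q] (by simp [Fin.forall_fin_two, hp, hq]) _ (defSet_eq 0 1)
      (fun i => by simp [hpq])
  choose g hg hg' using hG₁
  refine ⟨fun a => (g a).2, fun j => ?_, fun m R z hz => ?_⟩
  · exact hfun _ (hg _) _ (hG₀ _ (List.mem_ofFn.2 ⟨j, rfl⟩)) (hg' _)
  · exact key (fun j => g fun i => z i j) (fun j => hg _) _ (defSet_rel R id)
      (fun i => by
        change Structure.RelMap R fun j => (g fun i => z i j).1 i
        simpa only [hg'] using hz i)

end Forth

section BackAndForth

variable {L : FirstOrder.Language.{0, 0}} {M N : Type} [L.Structure M] [L.Structure N] {n : ℕ}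

theorem exists_cons_of_forall_formula [L.IsRelational] (hM : IsOmegaCategorical L M)
    {x : Fin n → M} {y : Fin n → N} (h : ∀ φ : L.Formula (Fin n), φ.Realize x ↔ φ.Realize y)
    (a : M) : ∃ b : N, ∀ φ : L.Formula (Fin (n + 1)),
      φ.Realize (Fin.cons a x : Fin (n + 1) → M) ↔ φ.Realize (Fin.cons b y : Fin (n + 1) → N) := by
  -- `θ` isolates the type of the extended tuple in `M`.
  obtain ⟨θ, -, hθ⟩ := defSet_defHull (s := .fo) hM fun _ : Unit => (Fin.cons a x : Fin (n + 1) → M)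
  let τ : Fin (n + 1) → Fin n ⊕ Unit := Fin.cons (Sum.inr ()) Sum.inl
  have hτ : ∀ {K : Type} (v : Fin n → K) (w : Unit → K),
      Sum.elim v w ∘ τ = (Fin.cons (w ()) v : Fin (n + 1) → K) := by
    intro K v w
    ext i
    refine Fin.cases ?_ (fun j => ?_) i <;> simp [τ]
  have hex := (h (Formula.iExs Unit (θ.relabel τ))).1 (by
    simp only [Formula.realize_iExs, Formula.realize_relabel, hτ]
    exact ⟨fun _ => a, (hθ _).1 (mem_defHull _ ())⟩)
  simp only [Formula.realize_iExs, Formula.realize_relabel, hτ] at hex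
  obtain ⟨b, hb⟩ := hex
  have himp : ∀ φ : L.Formula (Fin (n + 1)), φ.Realize (Fin.cons a x : Fin (n + 1) → M) →
      φ.Realize (Fin.cons (b ()) y : Fin (n + 1) → N) := by
    intro φ hφ
    have hall := (h (Formula.iAlls Unit ((θ.imp φ).relabel τ))).1 (by
      simp only [Formula.realize_iAlls, Formula.realize_relabel, hτ, Formula.realize_imp]
      intro c hc
      exact defHull_subset (s := .fo) (S := {z | φ.Realize z}) ⟨φ, trivial, fun _ => Iff.rfl⟩
        (fun _ => hφ) ((hθ _).2 hc))
    simp only [Formula.realize_iAlls, Formula.realize_relabel, hτ, Formula.realize_imp] at hall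
    exact hall b hb
  refine ⟨b (), fun φ => ⟨himp φ, fun hφ => ?_⟩⟩
  by_contra hn
  exact (Formula.realize_not.1 (himp φ.not (Formula.realize_not.2 hn))) hφ

/-- In countable ω-categorical structures, tuples of the same first-order type are matched by an
isomorphism. -/
theorem exists_equiv_of_forall_formula [L.IsRelational] [Countable M] [Countable N]
    (hM : IsOmegaCategorical L M) (hN : IsOmegaCategorical L N)
    {x : Fin n → M} {y : Fin n → N} (h : ∀ φ : L.Formula (Fin n), φ.Realize x ↔ φ.Realize y) :
    ∃ e : M ≃[L] N, ∀ j, e (x j) = y j := by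
  -- A list of pairs is admissible if its two sides have the same type.
  let T : List (M × N) → Prop := fun l => ∀ φ : L.Formula (Fin l.length),
    φ.Realize (fun j => (l.get j).1) ↔ φ.Realize (fun j => (l.get j).2)
  obtain ⟨G, hG₀, hG₁, hG₂⟩ := exists_set_of_forall_extension T
    (fun (i : M ⊕ N) p => Sum.elim (fun a => p.1 = a) (fun b => p.2 = b) i)
    (List.ofFn fun j => (x j, y j)) (by
      intro φ
      have hlen := List.length_ofFn (f := fun j => (x j, y j))
      simpa [Formula.realize_relabel, Function.comp_def, Fin.cast] using
        h (φ.relabel (Fin.cast hlen))) (by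
      rintro l hl (a | b)
      · obtain ⟨b, hb⟩ := exists_cons_of_forall_formula hM hl a
        refine ⟨(a, b), rfl, fun φ => ?_⟩
        rw [comp_get_cons Prod.fst, comp_get_cons Prod.snd]
        exact hb φ
      · obtain ⟨a, ha⟩ := exists_cons_of_forall_formula hN (fun φ => (hl φ).symm) b
        refine ⟨(a, b), rfl, fun φ => ?_⟩
        rw [comp_get_cons Prod.fst, comp_get_cons Prod.snd]
        exact (ha φ).symm)
  have key : ∀ {m : ℕ} (p : Fin m → M × N), (∀ j, p j ∈ G) → ∀ φ : L.Formula (Fin m),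
      φ.Realize (fun j => (p j).1) ↔ φ.Realize (fun j => (p j).2) := by
    intro m p hp φ
    obtain ⟨l, hl, hpl⟩ := hG₂ (Set.range p) (Set.finite_range p) (Set.range_subset_iff.2 hp)
    choose σ hσ using fun j => List.get_of_mem (hpl _ ⟨j, rfl⟩)
    simpa only [Formula.realize_relabel, Function.comp_def, hσ] using hl (φ.relabel σ)
  have hfun : ∀ p ∈ G, ∀ q ∈ G, p.1 = q.1 ↔ p.2 = q.2 := by
    intro p hp q hq
    simpa [Formula.realize_equal] using key ![p, q] (by simp [Fin.forall_fin_two, hp, hq])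
      ((Term.var 0).equal (Term.var 1))
  choose g hg hg' using fun a => hG₁ (.inl a)
  choose g' hg₂ hg₂' using fun b => hG₁ (.inr b)
  simp only [Sum.elim_inl, Sum.elim_inr] at hg' hg₂'
  refine ⟨{ toFun := fun a => (g a).2
            invFun := fun b => (g' b).1
            left_inv := fun a => ?_
            right_inv := fun b => ?_
            map_fun' := fun f => isEmptyElim f
            map_rel' := fun R z => ?_ }, fun j => ?_⟩
  · exact ((hfun _ (hg₂ _) _ (hg a)).2 (hg₂' _)).trans (hg' a)
  · exact ((hfun _ (hg _) _ (hg₂ b)).1 (hg' _)).trans (hg₂' b)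
  · simpa [Formula.realize_rel, hg', Function.comp_def] using
      (key (fun j => g (z j)) (fun j => hg _) (R.formula Term.var)).symm
  · exact (hfun _ (hg _) _ (hG₀ _ (List.mem_ofFn.2 ⟨j, rfl⟩))).1 (hg' _)

end BackAndForth

/-! ### Symmetries determine the definable sets -/

/-- `k` is the arity of some operation in the symmetry object of kind `s`. -/
def Kind.IsArity : Kind → ℕ → Prop
  | .fo, k => k = 1
  | .ep, k => k = 1
  | .pp, k => 1 ≤ k

section Galois

variable {L : FirstOrder.Language.{0, 0}} {M : Type} [L.Structure M] {s : Kind} {k n : ℕ}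

theorem isArity_of_mem_symOps {f : (Fin k → M) → M} (hf : f ∈ symOps L M s k) : s.IsArity k := by
  cases s with
  | fo => exact hf.1
  | ep => exact hf.1
  | pp => exact hf.1

theorem Kind.IsArity.one_le (h : s.IsArity k) : 1 ≤ k := by
  cases s with
  | fo => exact h.ge
  | ep => exact h.ge
  | pp => exact h

theorem isArity_one (s : Kind) : s.IsArity 1 := by
  cases s <;> simp [Kind.IsArity]

/-- The relations `O_{k,n}` in terms of definable sets: some `k`-ary symmetry maps given tuples
`x i` to `y` as soon as `y` belongs to every definable set that contains all the `x i`. -/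
theorem exists_mem_symOps_iff [L.IsRelational] [Countable M] (hM : IsOmegaCategorical L M)
    {x : Fin k → Fin n → M} {y : Fin n → M} :
    (∃ f ∈ symOps L M s k, ∀ j, y j = f fun i => x i j) ↔
      s.IsArity k ∧ ∀ S, DefSet L s S → (∀ i, x i ∈ S) → y ∈ S := by
  constructor
  · rintro ⟨f, hf, hy⟩
    refine ⟨isArity_of_mem_symOps hf, fun S hS hx => ?_⟩
    rw [funext hy]
    exact hS.preserves hf x hx
  · rintro ⟨hk, h⟩
    cases s with
    | fo =>
      obtain rfl : k = 1 := hk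
      obtain ⟨e, he⟩ := exists_equiv_of_forall_formula hM hM (x := x 0) (y := y) fun φ => by
        refine ⟨fun hφ => h {z | φ.Realize z} ⟨φ, trivial, fun _ => Iff.rfl⟩ fun i => ?_,
          fun hφ => ?_⟩
        · rwa [Subsingleton.elim i 0]
        · by_contra hn
          refine h {z | φ.Realize z}ᶜ ⟨φ.not, trivial, fun _ => Iff.rfl⟩ (fun i => ?_) hφ
          rwa [Subsingleton.elim i 0]
      exact ⟨fun z => e (z 0), ⟨rfl, e, fun _ => rfl⟩, fun j => (he j).symm⟩
    | ep =>
      obtain rfl : k = 1 := hk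
      obtain ⟨f, hf, hR⟩ := exists_operation_of_forall_defSet hM h
      refine ⟨f, ⟨rfl, ⟨fun a => f fun _ => a, fun f => isEmptyElim f,
        fun R z hz => hR _ R (fun _ => z) fun _ => hz⟩, fun z => ?_⟩, fun j => (hf j).symm⟩
      exact congrArg f (funext fun i => congrArg z (Subsingleton.elim _ _))
    | pp =>
      obtain ⟨f, hf, hR⟩ := exists_operation_of_forall_defSet hM h
      exact ⟨f, ⟨hk, hR⟩, fun j => (hf j).symm⟩

/-- The Galois connection between definable relations and symmetries. -/
theorem defSet_iff_forall_preserves [L.IsRelational] [Countable M] (hM : IsOmegaCategorical L M)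
    {S : Set (Fin n → M)} :
    DefSet L s S ↔ ∀ k, ∀ f ∈ symOps L M s k, Preserves f S := by
  refine ⟨fun hS k f hf => hS.preserves hf, fun h => ?_⟩
  by_cases hs : s = .pp
  · subst hs
    rcases Set.eq_empty_or_nonempty S with rfl | ⟨x₀, hx₀⟩
    · exact defSet_empty
    -- Finitely many tuples in `S` witness all failures of inclusions of `S` in definable sets.
    have := (finite_setOf_defSet hM .pp n).to_subtype
    obtain ⟨k, ⟨e⟩⟩ := Finite.exists_equiv_fin {S : Set (Fin n → M) | DefSet L .pp S}
    have hw : ∀ T : Set (Fin n → M), ∃ x ∈ S, x ∈ T → S ⊆ T := by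
      intro T
      by_cases hT : S ⊆ T
      · exact ⟨x₀, hx₀, fun _ => hT⟩
      · obtain ⟨x, hx, hxT⟩ := Set.not_subset.1 hT
        exact ⟨x, hx, fun h => absurd h hxT⟩
    choose w hwS hwT using hw
    have hk : 1 ≤ k := Fin.pos (e ⟨Set.univ, defSet_univ⟩)
    convert defSet_defHull (s := .pp) hM fun i => w (e.symm i)
    refine Set.Subset.antisymm (fun y hy T hT => ?_) fun y hy => ?_
    · refine hwT T ?_ hy
      simpa using hT.2 (e ⟨T, hT.1⟩)
    · obtain ⟨f, hf, hfy⟩ := (exists_mem_symOps_iff (s := .pp) hM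
        (x := fun i => w (e.symm i))).2 ⟨hk, fun T hT hx => hy T ⟨hT, hx⟩⟩
      rw [funext hfy]
      exact h k f hf _ fun i => hwS _
  · convert defSet_sUnion hs hM
      (P := Set.range fun x : S => defHull L s fun _ : Fin 1 => x.1)
      (by rintro _ ⟨x, rfl⟩; exact defSet_defHull hM _)
    refine Set.Subset.antisymm (fun x hx => ⟨_, ⟨⟨x, hx⟩, rfl⟩, mem_defHull _ 0⟩) ?_
    rintro y ⟨_, ⟨⟨x, hx⟩, rfl⟩, hy⟩
    obtain ⟨f, hf, hfy⟩ := (exists_mem_symOps_iff (s := s) hM (x := fun _ : Fin 1 => x)).2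
      ⟨isArity_one s, fun T hT hx => hy T ⟨hT, hx⟩⟩
    rw [funext hfy]
    exact h 1 f hf _ fun _ => hx

end Galois

/-! ### Bi-definitions are isomorphisms of actions -/

section Conjugation

variable {L L' : FirstOrder.Language.{0, 0}} {M N : Type} [L.Structure M] [L'.Structure N]
  {s : Kind} {k n : ℕ}

/-- The conjugate of an operation by a bijection. -/
def conjOp (θ : M ≃ N) (f : (Fin k → M) → M) : (Fin k → N) → N :=
  fun y => θ (f fun i => θ.symm (y i))

theorem conjOp_symm_conjOp (θ : M ≃ N) (f : (Fin k → M) → M) :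
    conjOp θ.symm (conjOp θ f) = f := by
  ext; simp [conjOp]

theorem conjOp_conjOp_symm (θ : M ≃ N) (f : (Fin k → N) → N) :
    conjOp θ (conjOp θ.symm f) = f := by
  ext; simp [conjOp]

theorem isActionIso_iff {𝒜 : Ops M} {ℬ : Ops N} {θ : M ≃ N} :
    IsActionIso 𝒜 ℬ θ ↔
      (∀ k, ∀ f ∈ 𝒜 k, conjOp θ f ∈ ℬ k) ∧ ∀ k, ∀ f ∈ ℬ k, conjOp θ.symm f ∈ 𝒜 k := by
  constructor
  · intro h
    refine ⟨fun k f hf => ?_, fun k f hf => ?_⟩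
    · rw [h k]
      exact ⟨f, hf, rfl⟩
    · rw [h k] at hf
      obtain ⟨f, hf, rfl⟩ := hf
      exact (congrArg (· ∈ 𝒜 k) (conjOp_symm_conjOp θ f)).mpr hf
  · rintro ⟨h₁, h₂⟩ k
    refine Set.Subset.antisymm (fun f hf => ⟨_, h₂ k f hf, conjOp_conjOp_symm θ f⟩) ?_
    rintro _ ⟨f, hf, rfl⟩
    exact h₁ k f hf

theorem mem_image_equiv (θ : M ≃ N) (S : Set (Fin n → M)) (y : Fin n → N) :
    y ∈ (fun (x : Fin n → M) (i : Fin n) => θ (x i)) '' S ↔ (fun i => θ.symm (y i)) ∈ S := by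
  constructor
  · rintro ⟨x, hx, rfl⟩
    simpa using hx
  · intro h
    exact ⟨_, h, by simp⟩

theorem preserves_conjOp_iff (θ : M ≃ N) (f : (Fin k → M) → M) (S : Set (Fin n → N)) :
    Preserves (conjOp θ f) S ↔
      Preserves f ((fun (x : Fin n → N) (i : Fin n) => θ.symm (x i)) '' S) := by
  constructor
  · intro h x hx
    rw [mem_image_equiv]
    have := h (fun i j => θ (x i j)) fun i => (mem_image_equiv θ.symm S _).1 (hx i)
    simpa [conjOp] using this
  · intro h x hx
    have := h (fun i j => θ.symm (x i j)) fun i => ⟨_, hx i, rfl⟩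
    exact (mem_image_equiv θ.symm S _).1 this

/-- For automorphisms, the conjugate is bijective because the given operation is, and
preserving definable sets along with their complements makes it an automorphism. -/
theorem conjOp_mem_symOps [L'.IsRelational] (θ : M ≃ N) {f : (Fin k → M) → M}
    (hf : f ∈ symOps L M s k)
    (h : ∀ (n : ℕ) (S : Set (Fin n → N)), DefSet L' s S → Preserves (conjOp θ f) S) :
    conjOp θ f ∈ symOps L' N s k := by
  cases s with
  | fo =>
    obtain ⟨rfl, g, hg⟩ := hf
    refine ⟨rfl, ⟨θ.symm.trans (g.toEquiv.trans θ), fun f => isEmptyElim f,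
      fun {n} R x => ⟨fun hx => ?_, fun hx => ?_⟩⟩, fun x => congrArg θ (hg _)⟩
    · by_contra hn
      obtain ⟨φ, -, hφ⟩ := defSet_rel (s := .fo) (M := N) R (id : Fin n → Fin n)
      have := h n {x | Structure.RelMap R x}ᶜ
        ⟨φ.not, trivial, fun x => not_congr (hφ x)⟩ (fun _ => x) fun _ => hn
      simp only [conjOp, hg] at this
      exact this hx
    · have := h n {x | Structure.RelMap R x} (defSet_rel R id) (fun _ => x) fun _ => hx
      simp only [conjOp, hg] at this
      exact this
  | ep =>
    obtain ⟨rfl, g, hg⟩ := hf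
    refine ⟨rfl, ⟨fun a => θ (g (θ.symm a)), fun f => isEmptyElim f,
      fun {n} R x hx => ?_⟩, fun x => congrArg θ (hg _)⟩
    have := h n {x | Structure.RelMap R x} (defSet_rel R id) (fun _ => x) fun _ => hx
    simp only [conjOp, hg] at this
    exact this
  | pp => exact ⟨hf.1, fun n R => h n {x | Structure.RelMap R x} (defSet_rel R id)⟩

theorem IsBiDefinition.isActionIso [L.IsRelational] [L'.IsRelational] {θ : M ≃ N}
    (h : IsBiDefinition s L L' θ) : IsActionIso (symOps L M s) (symOps L' N s) θ := by
  refine isActionIso_iff.2 ⟨fun k f hf => conjOp_mem_symOps θ hf fun n S hS => ?_,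
    fun k f hf => conjOp_mem_symOps θ.symm hf fun n S hS => ?_⟩
  · exact (preserves_conjOp_iff θ f S).2 (DefSet.preserves (h.2 n S hS) hf)
  · exact (preserves_conjOp_iff θ.symm f S).2 (DefSet.preserves (h.1 n S hS) hf)

theorem isBiDefinition_iff_isActionIso [L.IsRelational] [L'.IsRelational] [Countable M]
    [Countable N] (hM : IsOmegaCategorical L M) (hN : IsOmegaCategorical L' N) {θ : M ≃ N} :
    IsBiDefinition s L L' θ ↔ IsActionIso (symOps L M s) (symOps L' N s) θ := by
  refine ⟨IsBiDefinition.isActionIso, fun h => ?_⟩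
  obtain ⟨h₁, h₂⟩ := isActionIso_iff.1 h
  refine ⟨fun n S hS => (defSet_iff_forall_preserves hN).2 fun k f hf => ?_,
    fun n S hS => (defSet_iff_forall_preserves hM).2 fun k f hf => ?_⟩
  · exact (preserves_conjOp_iff θ.symm f S).1 (DefSet.preserves hS (h₂ k f hf))
  · exact (preserves_conjOp_iff θ f S).1 (DefSet.preserves hS (h₁ k f hf))

/-! ### The structure `𝔼_𝒜` encodes the action of `𝒜` -/

instance : orbitLang.IsRelational := fun _ => inferInstanceAs (IsEmpty Empty)

theorem exists_equiv_E_of_isActionIso {𝒜 : Ops M} {ℬ : Ops N} {θ : M ≃ N}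
    (h : IsActionIso 𝒜 ℬ θ) : ∃ e : E 𝒜 ≃[orbitLang] E ℬ, ∀ a : M, e a = θ a := by
  obtain ⟨h₁, h₂⟩ := isActionIso_iff.1 h
  refine ⟨⟨θ, fun f => isEmptyElim f, fun {r} R t => ?_⟩, fun _ => rfl⟩
  cases R with
  | O k n hk hn =>
    constructor
    · rintro ⟨f, hf, hft⟩
      refine ⟨_, h₂ k f hf, fun j => ?_⟩
      exact (θ.symm_apply_apply _).symm.trans (congrArg θ.symm (hft j))
    · rintro ⟨f, hf, hft⟩
      refine ⟨_, h₁ k f hf, fun j => ?_⟩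
      exact (congrArg θ (hft j)).trans
        (congrArg (fun z => θ (f z)) (funext fun i => (θ.symm_apply_apply _).symm))

/-- The tuple that consists of the blocks `x 0, …, x (k - 1), y`. -/
def blocks (x : Fin k → Fin n → M) (y : Fin n → M) : Fin ((k + 1) * n) → M := fun i =>
  Fin.snoc (α := fun _ => Fin n → M) x y (finProdFinEquiv.symm i).1 (finProdFinEquiv.symm i).2

theorem comp_blocks (g : M → N) (x : Fin k → Fin n → M) (y : Fin n → M) :
    g ∘ blocks x y = blocks (fun i j => g (x i j)) fun j => g (y j) := by
  ext i
  obtain ⟨⟨i, j⟩, rfl⟩ := finProdFinEquiv.surjective i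
  simp only [blocks, Function.comp_apply, Equiv.symm_apply_apply]
  refine Fin.lastCases ?_ (fun i => ?_) i <;> simp

theorem relMap_O_blocks_iff (𝒜 : Ops M) (hk : 1 ≤ k) (hn : 1 ≤ n) (x : Fin k → Fin n → M)
    (y : Fin n → M) :
    Structure.RelMap (L := orbitLang) (M := E 𝒜) (OrbitRel.O k n hk hn) (blocks x y) ↔
      ∃ f ∈ 𝒜 k, ∀ j, y j = f fun i => x i j := by
  change (∃ f ∈ 𝒜 k, ∀ j : Fin n, blocks x y _ = f fun i : Fin k => blocks x y _) ↔ _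
  simp only [blocks, Equiv.symm_apply_apply, Fin.snoc_last, Fin.snoc_castSucc]

/-- An isomorphism between the structures `𝔼` conjugates symmetries to operations that agree with
symmetries on all finite sets, and hence preserve all definable sets. -/
theorem conjOp_mem_symOps_of_equiv [L'.IsRelational]
    (e : E (symOps L M s) ≃[orbitLang] E (symOps L' N s)) {θ : M ≃ N} (he : ∀ a : M, e a = θ a)
    {f : (Fin k → M) → M} (hf : f ∈ symOps L M s k) :
    conjOp θ f ∈ symOps L' N s k := by
  refine conjOp_mem_symOps θ hf fun n S hS x hx => ?_
  have hk := (isArity_of_mem_symOps hf).one_le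
  -- No symbol `O_{k,0}` exists, but all tuples of length `0` are equal.
  rcases Nat.eq_zero_or_pos n with rfl | hn
  · rw [Subsingleton.elim (fun a : Fin 0 => _) (x ⟨0, hk⟩)]
    exact hx _
  have h := (e.map_rel (OrbitRel.O k n hk hn) _).2 <|
    (relMap_O_blocks_iff (symOps L M s) hk hn (fun i j => θ.symm (x i j))
      fun j => f fun i => θ.symm (x i j)).2 ⟨f, hf, fun _ => rfl⟩
  have hblocks : e ∘ blocks (fun i j => θ.symm (x i j)) (fun j => f fun i => θ.symm (x i j)) =
      blocks x fun j => conjOp θ f fun i => x i j := by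
    refine (congrArg (· ∘ blocks _ _) (funext he : (e : M → N) = θ)).trans ?_
    refine (comp_blocks θ _ _).trans ?_
    simp [conjOp]
  obtain ⟨g, hg, hgx⟩ := (relMap_O_blocks_iff (symOps L' N s) hk hn x _).1 (hblocks ▸ h)
  rw [funext hgx]
  exact hS.preserves hg x hx

theorem exists_equiv_E_iff_isActionIso [L.IsRelational] [L'.IsRelational] {θ : M ≃ N} :
    (∃ e : E (symOps L M s) ≃[orbitLang] E (symOps L' N s), ∀ a : M, e a = θ a) ↔
      IsActionIso (symOps L M s) (symOps L' N s) θ := by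
  refine ⟨?_, exists_equiv_E_of_isActionIso⟩
  rintro ⟨e, he⟩
  refine isActionIso_iff.2 ⟨fun k f hf => conjOp_mem_symOps_of_equiv e he hf,
    fun k f hf => conjOp_mem_symOps_of_equiv e.symm (fun a => ?_) hf⟩
  apply e.injective
  exact (e.apply_symm_apply a).trans ((he _).trans (θ.apply_symm_apply a)).symm

theorem isBiDefinition_of_equiv (g : M ≃[L] M) : IsBiDefinition s L L g.toEquiv := by
  have key : ∀ (g : M ≃[L] M) (n : ℕ) (S : Set (Fin n → M)), DefSet L s S →
      (fun (x : Fin n → M) (i : Fin n) => g.toEquiv (x i)) '' S = S := by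
    intro g n S hS
    ext y
    rw [mem_image_equiv]
    exact hS.equiv_comp_mem g.symm
  refine ⟨fun n S hS => ?_, fun n S hS => ?_⟩
  · rwa [key g n S hS]
  · exact (congrArg (IsDefinable L M s) (key g.symm n S hS)).mpr hS

/-- Automorphisms of a structure are bi-definitions, and hence automorphisms of its `𝔼`. -/
theorem isOmegaCategorical_E [L.IsRelational] (hM : IsOmegaCategorical L M) :
    IsOmegaCategorical orbitLang (E (symOps L M s)) := by
  intro n
  have := hM n
  let r : (Fin n → M) → (Fin n → M) → Prop := fun x y => ∃ g : M ≃[L] M, ∀ i, y i = g (x i)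
  have hr : ∀ x y, r x y → ∃ e : E (symOps L M s) ≃[orbitLang] E (symOps L M s),
      ∀ i, y i = e (x i) := by
    rintro x y ⟨g, hg⟩
    obtain ⟨e, he⟩ :=
      exists_equiv_E_of_isActionIso (isBiDefinition_of_equiv (s := s) g).isActionIso
    exact ⟨e, fun i => (hg i).trans (he _).symm⟩
  refine Finite.of_surjective (α := Quot r) (Quot.map id hr) ?_
  rintro ⟨x⟩
  exact ⟨Quot.mk r x, rfl⟩

end Conjugation

/-! ### Satisfaction in a measurable family of structures -/

section Measurability

variable {L : FirstOrder.Language.{0, 0}} [L.IsRelational] {X : Type} [MeasurableSpace X]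
  {P : X → ℕ → Prop} {α : Type}

/-- If the domain, a subset of `ℕ`, and the relations of a structure depend measurably on a
parameter, then so does satisfaction of each formula. -/
theorem measurableSet_realize [Finite α] (S : ∀ x, L.Structure {a // P x a})
    (hP : ∀ a, MeasurableSet {x | P x a})
    (hR : ∀ {n : ℕ} (R : L.Relations n) (t : Fin n → ℕ), MeasurableSet
      {x | ∃ h : ∀ i, P x (t i), (S x).RelMap R fun i => ⟨t i, h i⟩})
    {m : ℕ} (φ : L.BoundedFormula α m) (v : α → ℕ) (w : Fin m → ℕ) :
    MeasurableSet {x | ∃ (hv : ∀ i, P x (v i)) (hw : ∀ i, P x (w i)),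
      φ.Realize (fun i => (⟨v i, hv i⟩ : {a // P x a})) fun i => ⟨w i, hw i⟩} := by
  have hdom : ∀ {m : ℕ} (w : Fin m → ℕ),
      MeasurableSet {x | (∀ i, P x (v i)) ∧ ∀ i, P x (w i)} := fun w => by
    have h₁ : MeasurableSet {x | ∀ i, P x (v i)} := by
      simpa only [Set.ofPred_forall] using MeasurableSet.iInter fun i => hP (v i)
    have h₂ : MeasurableSet {x | ∀ i, P x (w i)} := by
      simpa only [Set.ofPred_forall] using MeasurableSet.iInter fun i => hP (w i)
    exact h₁.inter h₂
  induction φ with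
  | falsum =>
    convert MeasurableSet.empty
    ext x
    simp [BoundedFormula.Realize]
  | @equal m t₁ t₂ =>
    obtain ⟨i, rfl⟩ := term_eq_var t₁
    obtain ⟨j, rfl⟩ := term_eq_var t₂
    by_cases hij : Sum.elim v w i = Sum.elim v w j
    · convert hdom w using 1
      ext x
      constructor
      · rintro ⟨hv, hw, -⟩
        exact ⟨hv, hw⟩
      · rintro ⟨hv, hw⟩
        refine ⟨hv, hw, ?_⟩
        apply Subtype.ext
        rcases i with i | i <;> rcases j with j | j <;> exact hij
    · convert MeasurableSet.empty
      ext x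
      refine ⟨?_, False.elim⟩
      rintro ⟨hv, hw, h⟩
      refine hij ?_
      have h' := congrArg Subtype.val h
      rcases i with i | i <;> rcases j with j | j <;> exact h'
  | @rel m n R ts =>
    choose σ hσ using fun i => term_eq_var (ts i)
    obtain rfl : ts = fun i => Term.var (σ i) := funext hσ
    convert (hdom w).inter (hR R fun i => Sum.elim v w (σ i)) using 1
    ext x
    have key : ∀ (hv : ∀ i, P x (v i)) (hw : ∀ i, P x (w i))
        (h : ∀ i, P x (Sum.elim v w (σ i))) (i : Fin n),
        (Sum.elim (fun i => (⟨v i, hv i⟩ : {a // P x a})) (fun i => ⟨w i, hw i⟩) (σ i)) =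
          ⟨Sum.elim v w (σ i), h i⟩ := by
      intro hv hw h i
      apply Subtype.ext
      change _ = Sum.elim v w (σ i)
      rcases σ i with j | j <;> rfl
    constructor
    · rintro ⟨hv, hw, h⟩
      have hd : ∀ i, P x (Sum.elim v w (σ i)) := fun i => by
        rcases σ i with j | j
        exacts [hv j, hw j]
      refine ⟨⟨hv, hw⟩, hd, ?_⟩
      rw [← funext (key hv hw hd)]
      exact h
    · rintro ⟨⟨hv, hw⟩, hd, h⟩
      refine ⟨hv, hw, ?_⟩
      rw [← funext (key hv hw hd)] at h
      exact h
  | imp φ ψ ihφ ihψ =>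
    convert (hdom w).inter ((ihφ w).compl.union (ihψ w)) using 1
    ext x
    simp only [BoundedFormula.realize_imp, Set.mem_ofPred_eq, Set.mem_inter_iff, Set.mem_union,
      Set.mem_compl_iff]
    constructor
    · rintro ⟨hv, hw, h⟩
      refine ⟨⟨hv, hw⟩, ?_⟩
      by_cases hφ : φ.Realize (fun i => (⟨v i, hv i⟩ : {a // P x a})) fun i => ⟨w i, hw i⟩
      · exact .inr ⟨hv, hw, h hφ⟩
      · exact .inl fun ⟨_, _, h'⟩ => hφ h'
    · rintro ⟨⟨hv, hw⟩, h | ⟨_, _, h⟩⟩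
      · exact ⟨hv, hw, fun hφ => absurd ⟨hv, hw, hφ⟩ h⟩
      · exact ⟨hv, hw, fun _ => h⟩
  | @all m φ ih =>
    convert (hdom w).inter (MeasurableSet.iInter fun a =>
      (hP a).compl.union (ih (Fin.snoc (α := fun _ => ℕ) w a))) using 1
    ext x
    have key : ∀ (hw : ∀ i, P x (w i)) (a : ℕ) (ha : P x a)
        (h : ∀ i, P x (Fin.snoc (α := fun _ => ℕ) w a i)),
        (Fin.snoc (fun i => ⟨w i, hw i⟩) ⟨a, ha⟩ : Fin (m + 1) → {a // P x a}) =
          fun i => ⟨Fin.snoc (α := fun _ => ℕ) w a i, h i⟩ := by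
      intro hw a ha h
      ext i
      refine Fin.lastCases ?_ (fun i => ?_) i <;> simp
    simp only [BoundedFormula.realize_all, Set.mem_ofPred_eq, Set.mem_inter_iff, Set.mem_iInter,
      Set.mem_union, Set.mem_compl_iff]
    constructor
    · rintro ⟨hv, hw, h⟩
      refine ⟨⟨hv, hw⟩, fun a => ?_⟩
      by_cases ha : P x a
      · have hw' : ∀ i, P x (Fin.snoc (α := fun _ => ℕ) w a i) := by
          intro i
          refine Fin.lastCases ?_ (fun i => ?_) i
          · simpa using ha
          · simpa using hw i
        refine .inr ⟨hv, hw', ?_⟩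
        rw [← key hw a ha hw']
        exact h _
      · exact .inl ha
    · rintro ⟨⟨hv, hw⟩, h⟩
      refine ⟨hv, hw, fun ⟨a, ha⟩ => ?_⟩
      obtain h | ⟨hv, hw', h⟩ := h a
      · exact absurd ha h
      · rw [key hw a ha hw']
        exact h

theorem measurableSet_realize_formula [Finite α] (S : ∀ x, L.Structure {a // P x a})
    (hP : ∀ a, MeasurableSet {x | P x a})
    (hR : ∀ {n : ℕ} (R : L.Relations n) (t : Fin n → ℕ), MeasurableSet
      {x | ∃ h : ∀ i, P x (t i), (S x).RelMap R fun i => ⟨t i, h i⟩})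
    (φ : L.Formula α) (v : α → ℕ) :
    MeasurableSet {x | ∃ hv : ∀ i, P x (v i),
      φ.Realize fun i => (⟨v i, hv i⟩ : {a // P x a})} := by
  convert measurableSet_realize S hP hR φ v Fin.elim0 using 1
  ext x
  constructor
  · rintro ⟨hv, h⟩
    refine ⟨hv, fun i => i.elim0, ?_⟩
    rwa [Formula.Realize, Subsingleton.elim (default : Fin 0 → {a // P x a})] at h
  · rintro ⟨hv, _, h⟩
    refine ⟨hv, ?_⟩
    rwa [Formula.Realize, Subsingleton.elim (default : Fin 0 → {a // P x a})]

end Measurability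

/-! ### A common signature for all codes -/

/-- If each relation of the `L`-structure on `M` is empty or a relation of the `L'`-structure, then
automorphisms of the latter are automorphisms of the former. -/
theorem exists_equiv_of_forall_relations {L L' : FirstOrder.Language.{0, 0}} [L.IsRelational]
    {M : Type} [L.Structure M] [L'.Structure M]
    (h : ∀ (n : ℕ) (R : L.Relations n), (∀ x : Fin n → M, ¬ Structure.RelMap R x) ∨
      ∃ R' : L'.Relations n, ∀ x : Fin n → M, Structure.RelMap R x ↔ Structure.RelMap R' x)
    (g : M ≃[L'] M) : ∃ g' : M ≃[L] M, ∀ a, g' a = g a := by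
  refine ⟨⟨g.toEquiv, fun f => isEmptyElim f, fun {n} R x => ?_⟩, fun _ => rfl⟩
  obtain hR | ⟨R', hR⟩ := h n R
  · simp [hR]
  · rw [hR, hR]
    exact g.map_rel R' x

theorem symOps_subset_of_forall_relations {L L' : FirstOrder.Language.{0, 0}} [L.IsRelational]
    {M : Type} [L.Structure M] [L'.Structure M]
    (h : ∀ (n : ℕ) (R : L.Relations n), (∀ x : Fin n → M, ¬ Structure.RelMap R x) ∨
      ∃ R' : L'.Relations n, ∀ x : Fin n → M, Structure.RelMap R x ↔ Structure.RelMap R' x)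
    (s : Kind) (k : ℕ) : symOps L' M s k ⊆ symOps L M s k := by
  intro f hf
  cases s with
  | fo =>
    obtain ⟨hk, g, hg⟩ := hf
    obtain ⟨g', hg'⟩ := exists_equiv_of_forall_relations h g
    exact ⟨hk, g', fun x => (hg x).trans (hg' _).symm⟩
  | ep =>
    obtain ⟨hk, g, hg⟩ := hf
    refine ⟨hk, ⟨g, fun f => isEmptyElim f, fun {n} R x hx => ?_⟩, hg⟩
    obtain hR | ⟨R', hR⟩ := h n R
    · exact absurd hx (hR x)
    · rw [hR] at hx ⊢
      exact g.map_rel R' x hx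
  | pp =>
    refine ⟨hf.1, fun n R x hx => ?_⟩
    obtain hR | ⟨R', hR⟩ := h n R
    · exact absurd (hx ⟨0, hf.1⟩) (hR _)
    · simp only [hR] at hx ⊢
      exact hf.2 n R' x hx

/-- The relational language of all potential symbols of a code. -/
def potentialLang : FirstOrder.Language.{0, 0} := ⟨fun _ => Empty, fun _ => ℕ⟩

instance : potentialLang.IsRelational := fun _ => inferInstanceAs (IsEmpty Empty)

instance (c : Code) : c.lang.IsRelational := fun _ => inferInstanceAs (IsEmpty Empty)

instance (c : Code) : Countable c.Dom := inferInstanceAs (Countable {a : ℕ // c.1 a = true})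

/-- A natural number in the domain, as an element of the coded structure. -/
def Code.elem (c : Code) (a : ℕ) (h : c.1 a = true) : c.Dom := ⟨a, h⟩

/-- The coded structure, where symbols outside of the signature denote empty relations. -/
instance (c : Code) : potentialLang.Structure c.Dom where
  funMap f _ := Empty.elim f
  RelMap {n} i x := c.2.1 (n, i) = true ∧ c.2.2 ⟨n, i, fun j => (x j).1⟩ = true

theorem Code.relations_of_lang (c : Code) (n : ℕ) (R : c.lang.Relations n) :
    (∀ x : Fin n → c.Dom, ¬ Structure.RelMap R x) ∨ ∃ R' : potentialLang.Relations n,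
      ∀ x : Fin n → c.Dom, Structure.RelMap R x ↔ Structure.RelMap R' x :=
  .inr ⟨R.1, fun _ => (and_iff_right R.2).symm⟩

theorem Code.relations_of_potentialLang (c : Code) (n : ℕ) (R : potentialLang.Relations n) :
    (∀ x : Fin n → c.Dom, ¬ Structure.RelMap R x) ∨ ∃ R' : c.lang.Relations n,
      ∀ x : Fin n → c.Dom, Structure.RelMap R x ↔ Structure.RelMap R' x := by
  by_cases h : c.2.1 (n, R) = true
  · exact .inr ⟨⟨R, h⟩, fun _ => and_iff_right h⟩
  · exact .inl fun _ hx => h hx.1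

theorem sym_eq_symOps_potentialLang (s : Kind) (A : OmegaCat) :
    sym s A = symOps potentialLang A.1.Dom s :=
  funext fun k => Set.Subset.antisymm
    (symOps_subset_of_forall_relations A.1.relations_of_potentialLang s k)
    (symOps_subset_of_forall_relations A.1.relations_of_lang s k)

theorem isOmegaCategorical_potentialLang (A : OmegaCat) :
    IsOmegaCategorical potentialLang A.1.Dom := by
  intro n
  have := A.2 n
  let r : (Fin n → A.1.Dom) → (Fin n → A.1.Dom) → Prop :=
    fun x y => ∃ g : A.1.Dom ≃[A.1.lang] A.1.Dom, ∀ i, y i = g (x i)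
  have hr : ∀ x y, r x y → ∃ g : A.1.Dom ≃[potentialLang] A.1.Dom, ∀ i, y i = g (x i) := by
    rintro x y ⟨g, hg⟩
    obtain ⟨g', hg'⟩ := exists_equiv_of_forall_relations A.1.relations_of_potentialLang g
    exact ⟨g', fun i => (hg i).trans (hg' _).symm⟩
  refine Finite.of_surjective (α := Quot r) (Quot.map id hr) ?_
  rintro ⟨x⟩
  exact ⟨Quot.mk r x, rfl⟩

/-! ### The theory of `𝔼` is a Borel invariant -/

instance : Countable potentialLang.Symbols := by
  have : Countable (Σ n, potentialLang.Functions n) :=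
    inferInstanceAs (Countable (Σ _ : ℕ, Empty))
  have : Countable (Σ n, potentialLang.Relations n) :=
    inferInstanceAs (Countable (Σ _ : ℕ, ℕ))
  exact inferInstanceAs (Countable (_ ⊕ _))

instance : Countable orbitLang.Symbols := by
  have : Countable (Σ n, orbitLang.Functions n) :=
    inferInstanceAs (Countable (Σ _ : ℕ, Empty))
  have : Countable (Σ n, orbitLang.Relations n) := by
    let f : {p : ℕ × ℕ // 1 ≤ p.1 ∧ 1 ≤ p.2} → Σ n, orbitLang.Relations n :=
      fun p => ⟨_, OrbitRel.O p.1.1 p.1.2 p.2.1 p.2.2⟩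
    refine Function.Surjective.countable (f := f) ?_
    rintro ⟨_, ⟨k, n, hk, hn⟩⟩
    exact ⟨⟨(k, n), hk, hn⟩, rfl⟩
  exact inferInstanceAs (Countable (_ ⊕ _))

theorem measurableSet_dom (a : ℕ) : MeasurableSet {A : OmegaCat | A.1.1 a = true} := by
  have : Measurable fun A : OmegaCat => A.1.1 a := by fun_prop
  exact this (measurableSet_singleton true)

theorem measurableSet_forall_dom {n : ℕ} (t : Fin n → ℕ) :
    MeasurableSet {A : OmegaCat | ∀ i, A.1.1 (t i) = true} := by
  simpa only [Set.ofPred_forall] using MeasurableSet.iInter fun i => measurableSet_dom (t i)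

theorem measurableSet_realize_potentialLang {n : ℕ} (φ : potentialLang.Formula (Fin n))
    (t : Fin n → ℕ) :
    MeasurableSet {A : OmegaCat | ∃ h : ∀ i, A.1.1 (t i) = true,
      φ.Realize fun i => A.1.elem (t i) (h i)} := by
  have h := measurableSet_realize_formula (P := fun (A : OmegaCat) a => A.1.1 a = true)
    (fun A => inferInstanceAs (potentialLang.Structure A.1.Dom)) measurableSet_dom
    (fun {n} R t => by
      have h₁ : Measurable fun A : OmegaCat => A.1.2.1 (n, R) := by fun_prop
      have h₂ : Measurable fun A : OmegaCat => A.1.2.2 ⟨n, R, t⟩ := by fun_prop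
      convert (measurableSet_forall_dom t).inter ((h₁ (measurableSet_singleton true)).inter
        (h₂ (measurableSet_singleton true))) using 1
      ext A
      exact ⟨fun ⟨h, hR⟩ => ⟨h, hR⟩, fun ⟨h, hR⟩ => ⟨h, hR⟩⟩)
    φ t
  exact h

/-- The relations of `𝔼` are Borel, since existence of a symmetry that maps given tuples to a
given tuple can be tested on the countably many formulas of the right kind. -/
theorem measurableSet_relMap_E (s : Kind) {r : ℕ} (R : orbitLang.Relations r) (t : Fin r → ℕ) :
    MeasurableSet {A : OmegaCat | ∃ h : ∀ i, A.1.1 (t i) = true,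
      Structure.RelMap (M := E (sym s A)) R fun i => A.1.elem (t i) (h i)} := by
  cases R with
  | O k n hk hn =>
    let x : Fin k → Fin n → ℕ := fun i j => t (finProdFinEquiv (i.castSucc, j))
    let y : Fin n → ℕ := fun j => t (finProdFinEquiv (Fin.last k, j))
    have hB : ∀ (φ : potentialLang.Formula (Fin n)), MeasurableSet {A : OmegaCat |
        (∀ i, ∃ h : ∀ j, A.1.1 (x i j) = true, φ.Realize fun j => A.1.elem (x i j) (h j)) →
          ∃ h : ∀ j, A.1.1 (y j) = true, φ.Realize fun j => A.1.elem (y j) (h j)} := by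
      intro φ
      have h₁ := MeasurableSet.iInter fun i => measurableSet_realize_potentialLang φ (x i)
      have h₂ := measurableSet_realize_potentialLang φ y
      convert h₁.compl.union h₂ using 1
      ext A
      simp only [Set.mem_ofPred_eq, Set.mem_union, Set.mem_compl_iff, Set.mem_iInter]
      exact imp_iff_not_or
    convert (measurableSet_forall_dom t).inter ((MeasurableSet.const (s.IsArity k)).inter
      (MeasurableSet.iInter fun φ : {φ : potentialLang.Formula (Fin n) // IsOfKind s φ} =>
        hB φ.1)) using 1
    ext A
    have key : ∀ h : ∀ i, A.1.1 (t i) = true,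
        Structure.RelMap (L := orbitLang) (M := E (sym s A)) (OrbitRel.O k n hk hn)
          (fun i => A.1.elem (t i) (h i)) ↔
        s.IsArity k ∧ ∀ S : Set (Fin n → A.1.Dom), DefSet potentialLang s S →
          (∀ i, (fun j => A.1.elem (x i j) (h _)) ∈ S) →
            (fun j => A.1.elem (y j) (h _)) ∈ S := by
      intro h
      refine Iff.trans ?_ (exists_mem_symOps_iff (isOmegaCategorical_potentialLang A))
      rw [← sym_eq_symOps_potentialLang]
      exact Iff.rfl
    simp only [Set.mem_ofPred_eq, Set.mem_inter_iff, Set.mem_iInter]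
    constructor
    · rintro ⟨h, hO⟩
      obtain ⟨hs, hO⟩ := (key h).1 hO
      refine ⟨h, hs, fun φ hx => ⟨fun j => h _, ?_⟩⟩
      exact hO {z | φ.1.Realize z} ⟨φ.1, φ.2, fun _ => Iff.rfl⟩ fun i => (hx i).2
    · rintro ⟨h, hs, hφ⟩
      refine ⟨h, (key h).2 ⟨hs, ?_⟩⟩
      rintro S ⟨φ, hφs, hS⟩ hx
      exact (hS _).2 (hφ ⟨φ, hφs⟩ fun i => ⟨fun j => h _, (hS _).1 (hx i)⟩).2

theorem measurable_symTheory (s : Kind) : Measurable (symTheory s) := by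
  refine measurable_set_iff.2 fun φ => measurableSet_setOfPred.1 ?_
  convert measurableSet_realize_formula (P := fun (A : OmegaCat) a => A.1.1 a = true)
    (fun A => inferInstanceAs (orbitLang.Structure (E (sym s A)))) measurableSet_dom
    (measurableSet_relMap_E s) φ Empty.elim using 1
  ext A
  have hφ : φ ∈ symTheory s A ↔ Sentence.Realize (E (sym s A)) φ := Iff.rfl
  refine hφ.trans ⟨fun h => ⟨fun i => i.elim, ?_⟩, fun ⟨_, h⟩ => ?_⟩
  · rwa [Sentence.Realize, Subsingleton.elim (default : Empty → E (sym s A))] at h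
  · rwa [Sentence.Realize, Subsingleton.elim (default : Empty → E (sym s A))]

theorem biDefinable_iff_symTheory_eq (s : Kind) (A B : OmegaCat) :
    BiDefinable s A B ↔ symTheory s A = symTheory s B := by
  have key : ∀ θ : A.1.Dom ≃ B.1.Dom, IsBiDefinition s A.1.lang B.1.lang θ ↔
      ∃ e : E (sym s A) ≃[orbitLang] E (sym s B), ∀ a : A.1.Dom, e a = θ a := fun θ =>
    (isBiDefinition_iff_isActionIso A.2 B.2).trans exists_equiv_E_iff_isActionIso.symm
  constructor
  · rintro ⟨θ, hθ⟩
    obtain ⟨e, -⟩ := (key θ).1 hθ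
    exact Set.ext fun φ => StrongHomClass.realize_sentence e φ
  · intro h
    have : Countable (E (sym s A)) := inferInstanceAs (Countable A.1.Dom)
    have : Countable (E (sym s B)) := inferInstanceAs (Countable B.1.Dom)
    obtain ⟨e, -⟩ := exists_equiv_of_forall_formula (L := orbitLang)
      (M := E (sym s A)) (N := E (sym s B)) (isOmegaCategorical_E A.2) (isOmegaCategorical_E B.2)
      (x := Fin.elim0) (y := Fin.elim0) fun φ => by
        have h' := Set.ext_iff.1 h (φ.relabel Fin.elim0)
        change Sentence.Realize (E (sym s A)) _ ↔ Sentence.Realize (E (sym s B)) _ at h'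
        simp only [Sentence.Realize, Formula.realize_relabel] at h'
        rwa [Subsingleton.elim (default ∘ Fin.elim0 : Fin 0 → E (sym s A)) Fin.elim0,
          Subsingleton.elim (default ∘ Fin.elim0 : Fin 0 → E (sym s B)) Fin.elim0] at h'
    exact ⟨e.toEquiv, (key e.toEquiv).2 ⟨e, fun _ => rfl⟩⟩

theorem smoothRel_of_isBorelReduction {X α : Type} [MeasurableSpace X] [Countable α]
    {r : X → X → Prop} {f : X → Set α} (h : IsBorelReduction r (fun T T' => T = T') f) :
    SmoothRel r := by
  obtain ⟨g, hg⟩ := MeasureTheory.exists_measurableEmbedding_real (α → Prop)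
  have hmem : Measurable fun (T : Set α) (a : α) => a ∈ T :=
    measurable_pi_iff.2 fun a => measurable_set_mem a
  refine ⟨fun x => g fun a => a ∈ f x, hg.measurable.comp (hmem.comp h.1), fun x y => ?_⟩
  refine (h.2 x y).trans (Set.ext_iff.trans (Iff.trans ?_ hg.injective.eq_iff.symm))
  simp only [funext_iff, eq_iff_iff]

end BiDef

theorem mainTheorem4 (s : BiDef.Kind) :
    BiDef.SmoothRel (BiDef.BiDefinable s) ∧
    BiDef.IsBorelReduction (BiDef.BiDefinable s)
      (fun T T' : Set BiDef.orbitLang.Sentence => T = T') (BiDef.symTheory s) ∧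
    (∀ A : BiDef.OmegaCat,
      BiDef.IsOmegaCategorical BiDef.orbitLang (BiDef.E (BiDef.sym s A))) ∧
    (∀ (A B : BiDef.OmegaCat) (θ : A.1.Dom ≃ B.1.Dom),
      (∃ e : FirstOrder.Language.Equiv BiDef.orbitLang
          (BiDef.E (BiDef.sym s A)) (BiDef.E (BiDef.sym s B)), ∀ a : A.1.Dom, e a = θ a) ↔
        BiDef.IsActionIso (BiDef.sym s A) (BiDef.sym s B) θ) := by
  have h : BiDef.IsBorelReduction (BiDef.BiDefinable s)
      (fun T T' : Set BiDef.orbitLang.Sentence => T = T') (BiDef.symTheory s) :=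
    ⟨BiDef.measurable_symTheory s, BiDef.biDefinable_iff_symTheory_eq s⟩
  exact ⟨BiDef.smoothRel_of_isBorelReduction h, h, fun A => BiDef.isOmegaCategorical_E A.2,
    fun A B θ => BiDef.exists_equiv_E_iff_isActionIso⟩
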